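/- A semi-metric on a set $X$ is a function $d_X:X\times X\to[0,\infty)$ that is symmetric and satisfies $d_X(x,y)=0$ if and only if $x=y$ (no triangle inequality is required). For $r\ge 0$ let $d_X^{\,r}$ denote the semi-metric $(x,y)\mapsto d_X(x,y)^r$, with the convention $0^0=0$. For $0\le p<\infty$, $(X,d_X)$ has $p$-negative type if $\sum_{i,j=1}^n d_X(x_i,x_j)^p\xi_i\xi_j\le 0$ for all $n\ge 2$, all distinct $x_1,\dots,x_n\in X$ and all $\xi_1,\dots,\xi_n\in\mathbb R$ with $\sum_i\xi_i=0$; put $\wp_X=\sup\{p\ge 0: X\text{ has }p\text{-negative type}\}\in[0,\infty]$. For a semi-metric $\rho$ on $X$, a map $f:X\to\ell^2$ has distortion at most $C$ (where $1\le C<\infty$) if there is $s>0$ with $s\rho(x,y)\le\|f(x)-f(y)\|_2\le sC\rho(x,y)$ for all $x,y\in X$, and $c_2(X,\rho)\in[1,\infty]$ is the infimum of all such $C$ over all maps $f:X\to\ell^2$ ($\infty$ if there are none). Let $\mathcal O_n(\mathbb R)$ be the set of real symmetric positive semidefinite $n\times n$ matrices $Q$ with $Q\mathbb 1=0$, where $\mathbb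 1=(1,\dots,1)^T$. **Corollary 3.7.** Let $(X,d_X)$ be a finite semi-metric space and let $0\le p<\infty$ satisfy $p\ge\wp_X$. Then $C:=c_2(X,d_X^{\,p/2})$ is finite, and there is a non-trivial $p$-polygonal equality with distortion $C$ in $X$; that is, there exist $n\ge 2$, distinct points $x_1,\dots,x_n\in X$ and a nonzero matrix $Q=(q_{ij})_{i,j=1}^n\in\mathcal O_n(\mathbb R)$ such that $$\sum_{q_{ij}>0}d_X(x_i,x_j)^p\,q_{ij}+C^2\sum_{q_{ij}<0}d_X(x_i,x_j)^p\,q_{ij}=0.$$ -/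

import Mathlib

open scoped NNReal ENNReal Matrix

noncomputable section

/-- A semi-metric on `X`: a metric without the triangle inequality. -/
structure SemiMetric (X : Type*) where
  /-- the distance function -/
  d : X → X → ℝ
  nonneg : ∀ x y, 0 ≤ d x y
  eq_zero_iff : ∀ x y, d x y = 0 ↔ x = y
  symm : ∀ x y, d x y = d y x

namespace SemiMetric

/-- The distance of a metric space, as a semi-metric. -/
def ofMetricSpace (Y : Type*) [MetricSpace Y] : SemiMetric Y where
  d := fun x y => dist x y
  nonneg := fun _ _ => dist_nonneg
  eq_zero_iff := fun _ _ => dist_eq_zero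
  symm := fun x y => dist_comm x y

variable {X Y : Type*}

open Classical in
/-- The semi-metric `d ^ r`. Off the diagonal it is the real power of the (positive) distance; on the
diagonal it is `0`. So for `r ≠ 0` it is the plain real power everywhere, and for `r = 0` the
convention `0 ^ 0 = 0` is used, so that `d ^ 0` is the discrete metric. -/
def pow (D : SemiMetric X) (r : ℝ) : SemiMetric X where
  d := fun x y => if x = y then 0 else D.d x y ^ r
  nonneg := fun x y => by
    split_ifs
    · exact le_rfl
    · exact Real.rpow_nonneg (D.nonneg x y) r
  eq_zero_iff := fun x y => by
    by_cases h : x = y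
    · simp [h]
    · have hpos : 0 < D.d x y :=
        lt_of_le_of_ne (D.nonneg x y) (fun h0 => h ((D.eq_zero_iff x y).1 h0.symm))
      simp [h, (Real.rpow_pos_of_pos hpos r).ne']
  symm := fun x y => by
    simp only [D.symm x y, eq_comm]

/-- For a nonzero exponent the power is the plain real power, also on the diagonal. -/
theorem pow_d_of_ne_zero (D : SemiMetric X) {r : ℝ} (hr : r ≠ 0) (x y : X) :
    (D.pow r).d x y = D.d x y ^ r := by
  by_cases h : x = y
  · have h0 : D.d x y = 0 := (D.eq_zero_iff x y).2 h
    rw [h0, Real.zero_rpow hr]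
    exact ((D.pow r).eq_zero_iff x y).2 h
  · simp [pow, h]

/-- `X` has `p`-negative type. -/
def HasNegativeType (D : SemiMetric X) (p : ℝ≥0) : Prop :=
  ∀ (n : ℕ), 2 ≤ n → ∀ (x : Fin n → X), Function.Injective x →
    ∀ ξ : Fin n → ℝ, ∑ i, ξ i = 0 →
      ∑ i, ∑ j, (D.pow p).d (x i) (x j) * ξ i * ξ j ≤ 0

/-- The supremal `p`-negative type `℘_X`, a value in `[0, ∞]`. -/
def supremalNegativeType (D : SemiMetric X) : ℝ≥0∞ :=
  sSup {t : ℝ≥0∞ | ∃ p : ℝ≥0, D.HasNegativeType p ∧ t = (p : ℝ≥0∞)}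

/-- The map `f : (X, D) → (Y, E)` has distortion at most `C` (used for `1 ≤ C < ∞`). -/
def DistortionAtMost (D : SemiMetric X) (E : SemiMetric Y) (f : X → Y) (C : ℝ) : Prop :=
  ∃ s : ℝ, 0 < s ∧ ∀ x y, s * D.d x y ≤ E.d (f x) (f y) ∧ E.d (f x) (f y) ≤ s * C * D.d x y

/-- `dist(f)`: the smallest `1 ≤ C < ∞` such that `f` has distortion at most `C`, and `∞` if there
is no such `C`. -/
def distortion (D : SemiMetric X) (E : SemiMetric Y) (f : X → Y) : ℝ≥0∞ :=
  sInf {t : ℝ≥0∞ | ∃ C : ℝ, 1 ≤ C ∧ DistortionAtMost D E f C ∧ t = ENNReal.ofReal C}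

/-- `c_Y(X)`: the infimum of all `1 ≤ C ≤ ∞` such that some `f : X → Y` has `dist(f) ≤ C`. -/
def optimalDistortion (D : SemiMetric X) (E : SemiMetric Y) : ℝ≥0∞ :=
  sInf {C : ℝ≥0∞ | 1 ≤ C ∧ ∃ f : X → Y, distortion D E f ≤ C}

/-- The Euclidean distortion `c₂(X, D)`: the optimal distortion of maps into the real Hilbert
space `ℓ²` of square-summable sequences. -/
def euclideanDistortion (D : SemiMetric X) : ℝ≥0∞ :=
  optimalDistortion D (ofMetricSpace (lp (fun _ : ℕ => ℝ) 2))

end SemiMetric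

/-- The set `O_n(ℝ)` of real symmetric positive semidefinite `n × n` matrices `Q` with `Q 𝟙 = 0`. -/
def posSemidefKillingOnes (n : ℕ) : Set (Matrix (Fin n) (Fin n) ℝ) :=
  {Q | Q.PosSemidef ∧ Q *ᵥ (fun _ => (1 : ℝ)) = 0}

namespace SemiMetric

variable {X : Type*}

/-- The distorted sum: the sum of `d(x_i, x_j)^p q_ij` over `q_ij > 0`, plus `C ^ 2` times the sum of
`d(x_i, x_j)^p q_ij` over `q_ij < 0`. -/
def distortedSum (D : SemiMetric X) (p : ℝ≥0) (C : ℝ) {n : ℕ} (x : Fin n → X)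
    (Q : Matrix (Fin n) (Fin n) ℝ) : ℝ :=
  (∑ ij : Fin n × Fin n with 0 < Q ij.1 ij.2, (D.pow p).d (x ij.1) (x ij.2) * Q ij.1 ij.2) +
    C ^ 2 *
      ∑ ij : Fin n × Fin n with Q ij.1 ij.2 < 0, (D.pow p).d (x ij.1) (x ij.2) * Q ij.1 ij.2

/-- The points `x_1, …, x_n` and the matrix `Q` give a `p`-polygonal equality with distortion `C`. -/
def IsPolygonalEquality (D : SemiMetric X) (p : ℝ≥0) (C : ℝ) {n : ℕ} (x : Fin n → X)
    (Q : Matrix (Fin n) (Fin n) ℝ) : Prop :=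
  2 ≤ n ∧ Function.Injective x ∧ Q ∈ posSemidefKillingOnes n ∧ D.distortedSum p C x Q = 0

/-- There is a non-trivial (that is, `Q ≠ 0`) `p`-polygonal equality with distortion `C`. -/
def HasNontrivialPolygonalEquality (D : SemiMetric X) (p : ℝ≥0) (C : ℝ) : Prop :=
  ∃ (n : ℕ) (x : Fin n → X) (Q : Matrix (Fin n) (Fin n) ℝ),
    D.IsPolygonalEquality p C x Q ∧ Q ≠ 0

end SemiMetric

end

/-! Write `w = d ^ p`. For `Λ ≥ 1`, an embedding of `d ^ (p / 2)` into `ℓ²` with distortion at most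
`√Λ` exists exactly when `weightedGap w Λ` is non-positive on the cone `gramKillingOnes`. Necessity
holds because squared Euclidean distances pair non-positively with the cone
(`sum_sq_dist_mul_nonpos`). Sufficiency is a Hahn-Banach separation (`exists_negType_between`)
followed by Schoenberg's embedding. Hence `C ^ 2` is the least such `Λ`, and it is finite by
`exists_weightedGap_nonpos`.

A non-trivial polygonal equality is a nonzero zero of the gap at `Λ = C ^ 2`. Without one, the gap
is strictly negative on a compact base of the cone, which survives a small change of parameters
(`eventually_gap_nonpos`). If `C > 1`, decreasing `Λ` contradicts minimality. If `C = 1`, the gap is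
a linear pairing, and increasing the exponent gives negative type beyond `p ≥ ℘_X`, a contradiction.
-/

open scoped MatrixOrder Matrix.Norms.L2Operator in
/-- A real positive semidefinite matrix is a Gram matrix. -/
theorem exists_gram_factor {ι : Type*} [Fintype ι] {q : ι → ι → ℝ}
    (hs : ∀ i j, q i j = q j i) (hq : ∀ v : ι → ℝ, 0 ≤ ∑ i, ∑ j, v i * q i j * v j) :
    ∃ B : ι → ι → ℝ, ∀ i j, q i j = ∑ k, B k i * B k j := by
  classical
  have hp : (Matrix.of q).PosSemidef := by
    rw [Matrix.posSemidef_iff_dotProduct_mulVec]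
    refine ⟨?_, fun v => ?_⟩
    · ext i j
      simp [Matrix.conjTranspose_apply, hs i j]
    · have := hq v
      simpa [dotProduct, Matrix.mulVec, Finset.mul_sum, mul_assoc] using this
  obtain ⟨B, hB⟩ := CStarAlgebra.nonneg_iff_eq_star_mul_self.mp hp.nonneg
  refine ⟨B, fun i j => ?_⟩
  have := congrFun (congrFun hB i) j
  simpa [Matrix.mul_apply, Matrix.star_eq_conjTranspose] using this

/-! ### The cone of test matrices and the weighted gap. -/

/-- The functions `ι → ι → ℝ` that are symmetric and positive semidefinite with vanishing row
sums. -/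
def gramKillingOnes (ι : Type*) [Fintype ι] : Set (ι → ι → ℝ) :=
  {q | (∀ i j, q i j = q j i) ∧ (∀ i, ∑ j, q i j = 0) ∧
    ∀ v : ι → ℝ, 0 ≤ ∑ i, ∑ j, v i * q i j * v j}

theorem mem_posSemidefKillingOnes_iff {n : ℕ} {Q : Matrix (Fin n) (Fin n) ℝ} :
    Q ∈ posSemidefKillingOnes n ↔ (fun i j => Q i j) ∈ gramKillingOnes (Fin n) := by
  unfold posSemidefKillingOnes gramKillingOnes
  simp only [Set.mem_ofPred_eq, Matrix.posSemidef_iff_dotProduct_mulVec, and_assoc]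
  refine and_congr ?_ ?_
  · constructor
    · intro h i j
      simpa using (h.apply i j).symm
    · intro h
      ext i j
      simp [Matrix.conjTranspose_apply, h i j]
  · rw [and_comm]
    refine and_congr ?_ ?_
    · simp [funext_iff, Matrix.mulVec, dotProduct]
    · simp [dotProduct, Matrix.mulVec, Finset.mul_sum, mul_assoc]

theorem isClosed_gramKillingOnes (ι : Type*) [Fintype ι] : IsClosed (gramKillingOnes ι) := by
  have h : gramKillingOnes ι = (⋂ i, ⋂ j, {q : ι → ι → ℝ | q i j = q j i}) ∩
      ((⋂ i, {q : ι → ι → ℝ | ∑ j, q i j = 0}) ∩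
        ⋂ v : ι → ℝ, {q : ι → ι → ℝ | 0 ≤ ∑ i, ∑ j, v i * q i j * v j}) := by
    ext q; simp [gramKillingOnes]
  rw [h]
  refine (isClosed_iInter fun i => isClosed_iInter fun j => ?_).inter
    ((isClosed_iInter fun i => ?_).inter (isClosed_iInter fun v => ?_))
  · exact isClosed_eq (by fun_prop) (by fun_prop)
  · exact isClosed_eq (by fun_prop) (by fun_prop)
  · exact isClosed_le (by fun_prop) (by fun_prop)

theorem smul_mem_gramKillingOnes {ι : Type*} [Fintype ι] {q : ι → ι → ℝ}
    (hq : q ∈ gramKillingOnes ι) {c : ℝ} (hc : 0 ≤ c) : c • q ∈ gramKillingOnes ι := by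
  obtain ⟨h1, h2, h3⟩ := hq
  refine ⟨fun i j => ?_, fun i => ?_, fun v => ?_⟩
  · simp [h1 i j]
  · simp [← Finset.mul_sum, h2]
  · have : ∑ i, ∑ j, v i * (c • q) i j * v j = c * ∑ i, ∑ j, v i * q i j * v j := by
      simp only [Finset.mul_sum, Pi.smul_apply, smul_eq_mul]
      refine Finset.sum_congr rfl fun i _ => Finset.sum_congr rfl fun j _ => by ring
    rw [this]
    exact mul_nonneg hc (h3 v)

/-- The sum of `w q` over the positive part of `q`, plus `Λ` times the sum over the negative
part. -/
def weightedGap {ι : Type*} [Fintype ι] (w : ι → ι → ℝ) (Λ : ℝ) (q : ι → ι → ℝ) : ℝ :=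
  ∑ i, ∑ j, w i j * (max (q i j) 0 - Λ * max (-q i j) 0)

theorem SemiMetric.distortedSum_eq_weightedGap {X : Type*} (D : SemiMetric X) (p : ℝ≥0) (C : ℝ)
    {n : ℕ} (x : Fin n → X) (Q : Matrix (Fin n) (Fin n) ℝ) :
    D.distortedSum p C x Q =
      weightedGap (fun i j => (D.pow p).d (x i) (x j)) (C ^ 2) (fun i j => Q i j) := by
  unfold SemiMetric.distortedSum weightedGap
  rw [Finset.sum_filter, Finset.sum_filter, Finset.mul_sum, ← Finset.sum_add_distrib,
    ← Finset.univ_product_univ, Finset.sum_product]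
  refine Finset.sum_congr rfl fun i _ => Finset.sum_congr rfl fun j _ => ?_
  dsimp only
  rcases lt_trichotomy (Q i j) 0 with h | h | h
  · rw [if_neg h.not_gt, if_pos h, max_eq_right h.le, max_eq_left (by linarith)]; ring
  · simp [h]
  · rw [if_pos h, if_neg h.not_gt, max_eq_left h.le, max_eq_right (by linarith)]; ring

theorem weightedGap_one {ι : Type*} [Fintype ι] (w q : ι → ι → ℝ) :
    weightedGap w 1 q = ∑ i, ∑ j, w i j * q i j := by
  refine Finset.sum_congr rfl fun i _ => Finset.sum_congr rfl fun j _ => ?_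
  rcases le_total (q i j) 0 with h | h
  · rw [max_eq_right h, max_eq_left (by linarith)]; ring
  · rw [max_eq_left h, max_eq_right (by linarith)]; ring

theorem weightedGap_smul {ι : Type*} [Fintype ι] (w q : ι → ι → ℝ) (Λ : ℝ) {c : ℝ} (hc : 0 ≤ c) :
    weightedGap w Λ (c • q) = c * weightedGap w Λ q := by
  simp only [weightedGap, Finset.mul_sum]
  refine Finset.sum_congr rfl fun i _ => Finset.sum_congr rfl fun j _ => ?_
  have h1 : max ((c • q) i j) 0 = c * max (q i j) 0 := by
    rw [mul_max_of_nonneg _ _ hc]; simp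
  have h2 : max (-(c • q) i j) 0 = c * max (-q i j) 0 := by
    rw [mul_max_of_nonneg _ _ hc]; simp
  rw [h1, h2]; ring

theorem continuous_weightedGap {ι : Type*} [Fintype ι] (w : ι → ι → ℝ) :
    Continuous fun t : ℝ × (ι → ι → ℝ) => weightedGap w t.1 t.2 := by
  unfold weightedGap
  fun_prop

/-- The compact base of the cone `gramKillingOnes`. -/
theorem isCompact_gramKillingOnes_sphere (ι : Type*) [Fintype ι] :
    IsCompact (gramKillingOnes ι ∩ Metric.sphere 0 1) :=
  (isCompact_sphere _ _).inter_left (isClosed_gramKillingOnes ι)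

theorem normalize_mem_sphere {ι : Type*} [Fintype ι] {q : ι → ι → ℝ}
    (hq : q ∈ gramKillingOnes ι) (h0 : q ≠ 0) :
    ‖q‖⁻¹ • q ∈ gramKillingOnes ι ∩ Metric.sphere 0 1 := by
  refine ⟨smul_mem_gramKillingOnes hq (by positivity), ?_⟩
  have : ‖q‖ ≠ 0 := norm_ne_zero_iff.2 h0
  simp [norm_smul, this]

/-- Comparing the gap with a squared distance matrix. -/
theorem weightedGap_le {ι : Type*} [Fintype ι] {w M : ι → ι → ℝ} {Λ : ℝ}
    (h1 : ∀ i j, w i j ≤ M i j) (h2 : ∀ i j, M i j ≤ Λ * w i j) (q : ι → ι → ℝ) :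
    weightedGap w Λ q ≤ ∑ i, ∑ j, M i j * q i j := by
  refine Finset.sum_le_sum fun i _ => Finset.sum_le_sum fun j _ => ?_
  rcases le_total (q i j) 0 with h | h
  · rw [max_eq_right h, max_eq_left (by linarith)]; nlinarith [h2 i j]
  · rw [max_eq_left h, max_eq_right (by linarith)]; nlinarith [h1 i j]

/-- Expanding the square, zero row and column sums kill the norm terms; a factorization `q = Bᵀ B`
turns the rest into `-2` times a sum of squared norms. -/
theorem sum_sq_dist_mul_nonpos {ι E : Type*} [Fintype ι] [NormedAddCommGroup E]
    [InnerProductSpace ℝ E] (f : ι → E) {q : ι → ι → ℝ} (hq : q ∈ gramKillingOnes ι) :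
    ∑ i, ∑ j, ‖f i - f j‖ ^ 2 * q i j ≤ 0 := by
  obtain ⟨hs, h0, hp⟩ := hq
  have h0' : ∀ j, ∑ i, q i j = 0 := fun j => by simp_rw [hs _ j, h0]
  obtain ⟨B, hB⟩ := exists_gram_factor hs hp
  have key : ∑ i, ∑ j, inner ℝ (f i) (f j) * q i j = ∑ k, ‖∑ i, B k i • f i‖ ^ 2 := by
    have hk : ∀ k, ‖∑ i, B k i • f i‖ ^ 2 =
        ∑ i, ∑ j, inner ℝ (f i) (f j) * (B k i * B k j) := fun k => by
      rw [← real_inner_self_eq_norm_sq, sum_inner]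
      refine Finset.sum_congr rfl fun i _ => ?_
      rw [inner_sum]
      refine Finset.sum_congr rfl fun j _ => ?_
      rw [real_inner_smul_left, real_inner_smul_right]
      ring
    simp_rw [hk, hB, Finset.mul_sum]
    rw [Finset.sum_comm (s := Finset.univ (α := ι))]
    conv_rhs => rw [Finset.sum_comm]
    rw [Finset.sum_comm]
    exact Finset.sum_congr rfl fun i _ => Finset.sum_comm
  have e : ∑ i, ∑ j, ‖f i - f j‖ ^ 2 * q i j =
      ∑ i, ‖f i‖ ^ 2 * ∑ j, q i j + ∑ j, ‖f j‖ ^ 2 * ∑ i, q i j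
        - 2 * ∑ i, ∑ j, inner ℝ (f i) (f j) * q i j := by
    simp_rw [Finset.mul_sum]
    rw [Finset.sum_comm (f := fun j i => ‖f j‖ ^ 2 * q i j)]
    simp_rw [← Finset.sum_add_distrib, ← Finset.sum_sub_distrib]
    refine Finset.sum_congr rfl fun i _ => Finset.sum_congr rfl fun j _ => ?_
    rw [norm_sub_sq_real]; ring
  rw [e, key]
  simp only [h0, h0', mul_zero, Finset.sum_const_zero, zero_add, zero_sub]
  have : 0 ≤ ∑ k, ‖∑ i, B k i • f i‖ ^ 2 := Finset.sum_nonneg fun k _ => by positivity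
  linarith

/-- For large `Λ` the gap is non-positive. -/
theorem exists_weightedGap_nonpos {ι : Type*} [Fintype ι] {w : ι → ι → ℝ}
    (hd : ∀ i, w i i = 0) (hpos : ∀ i j, i ≠ j → 0 < w i j) :
    ∃ Λ : ℝ, 1 ≤ Λ ∧ ∀ q ∈ gramKillingOnes ι, weightedGap w Λ q ≤ 0 := by
  classical
  have hnn : ∀ i j, 0 ≤ w i j := fun i j => by
    by_cases h : i = j
    · rw [h, hd]
    · exact (hpos i j h).le
  set T := ∑ i, ∑ j, w i j with hT
  set S := ∑ i, ∑ j, (w i j)⁻¹ with hS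
  have hT0 : 0 ≤ T := Finset.sum_nonneg fun i _ => Finset.sum_nonneg fun j _ => hnn i j
  have le_sum : ∀ g : ι → ι → ℝ, (∀ i j, 0 ≤ g i j) → ∀ i j, g i j ≤ ∑ i, ∑ j, g i j := by
    intro g hg i j
    refine (Finset.single_le_sum (f := fun j => g i j) (fun j _ => hg i j)
      (Finset.mem_univ j)).trans ?_
    exact Finset.single_le_sum (f := fun i => ∑ j, g i j)
      (fun i _ => Finset.sum_nonneg fun j _ => hg i j) (Finset.mem_univ i)
  have hwT : ∀ i j, w i j ≤ T := le_sum w hnn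
  have hwS : ∀ i j, i ≠ j → 1 ≤ S * w i j := fun i j h => by
    have := le_sum (fun i j => (w i j)⁻¹) (fun i j => inv_nonneg.2 (hnn i j)) i j
    have h2 := mul_le_mul_of_nonneg_right this (hnn i j)
    rwa [inv_mul_cancel₀ (hpos i j h).ne'] at h2
  -- This choice gives `w ≤ T ≤ Λ w` off the diagonal, so the gap is at most `T` times the
  -- off-diagonal sum of `q`, which is minus its trace.
  refine ⟨max 1 (T * S), le_max_left _ _, fun q hq => ?_⟩
  obtain ⟨hs, h0, hp⟩ := hq
  have hdiag : ∀ i, 0 ≤ q i i := fun i => by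
    simpa [Pi.single_apply, ite_mul, mul_ite] using hp (Pi.single i 1)
  calc weightedGap w (max 1 (T * S)) q
      ≤ ∑ i, ∑ j, (T * q i j - if i = j then T * q i i else 0) := by
        refine Finset.sum_le_sum fun i _ => Finset.sum_le_sum fun j _ => ?_
        by_cases h : i = j
        · subst h; simp [hd]
        · rw [if_neg h, sub_zero]
          have h3 : T ≤ max 1 (T * S) * w i j := by
            calc T ≤ T * (S * w i j) := le_mul_of_one_le_right hT0 (hwS i j h)
              _ = (T * S) * w i j := by ring
              _ ≤ _ := mul_le_mul_of_nonneg_right (le_max_right _ _) (hnn i j)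
          generalize max 1 (T * S) = Λ at h3 ⊢
          rcases le_total (q i j) 0 with h | h
          · rw [max_eq_right h, max_eq_left (by linarith)]; nlinarith
          · rw [max_eq_left h, max_eq_right (by linarith)]; nlinarith [hwT i j]
    _ = -(T * ∑ i, q i i) := by
        simp [Finset.sum_sub_distrib, ← Finset.mul_sum, h0]
    _ ≤ 0 := by
        have := Finset.sum_nonneg fun i (_ : i ∈ Finset.univ) => hdiag i
        nlinarith

/-! ### Matrices of negative type and duality. -/

/-- The cone of symmetric matrices with zero diagonal that are of negative type. -/
def negTypeCone (ι : Type*) [Fintype ι] : Set (ι → ι → ℝ) :=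
  {M | (∀ i j, M i j = M j i) ∧ (∀ i, M i i = 0) ∧
    ∀ ξ : ι → ℝ, ∑ i, ξ i = 0 → ∑ i, ∑ j, M i j * ξ i * ξ j ≤ 0}

theorem isClosed_negTypeCone (ι : Type*) [Fintype ι] : IsClosed (negTypeCone ι) := by
  have h : negTypeCone ι = (⋂ i, ⋂ j, {M : ι → ι → ℝ | M i j = M j i}) ∩
      ((⋂ i, {M : ι → ι → ℝ | M i i = 0}) ∩
        ⋂ ξ : ι → ℝ, ⋂ _ : ∑ i, ξ i = 0, {M : ι → ι → ℝ | ∑ i, ∑ j, M i j * ξ i * ξ j ≤ 0}) := by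
    ext q; simp [negTypeCone]
  rw [h]
  refine (isClosed_iInter fun i => isClosed_iInter fun j => ?_).inter
    ((isClosed_iInter fun i => ?_).inter (isClosed_iInter fun v => isClosed_iInter fun _ => ?_))
  · exact isClosed_eq (by fun_prop) (by fun_prop)
  · exact isClosed_eq (by fun_prop) (by fun_prop)
  · exact isClosed_le (by fun_prop) (by fun_prop)

theorem smul_mem_negTypeCone {ι : Type*} [Fintype ι] {M : ι → ι → ℝ}
    (hM : M ∈ negTypeCone ι) {c : ℝ} (hc : 0 ≤ c) : c • M ∈ negTypeCone ι := by
  obtain ⟨h1, h2, h3⟩ := hM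
  refine ⟨fun i j => by simp [h1 i j], fun i => by simp [h2], fun ξ hξ => ?_⟩
  have : ∑ i, ∑ j, (c • M) i j * ξ i * ξ j = c * ∑ i, ∑ j, M i j * ξ i * ξ j := by
    simp only [Finset.mul_sum, Pi.smul_apply, smul_eq_mul, mul_assoc]
  rw [this]
  exact mul_nonpos_of_nonneg_of_nonpos hc (h3 ξ hξ)

theorem add_mem_negTypeCone {ι : Type*} [Fintype ι] {M N : ι → ι → ℝ}
    (hM : M ∈ negTypeCone ι) (hN : N ∈ negTypeCone ι) : M + N ∈ negTypeCone ι := by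
  obtain ⟨h1, h2, h3⟩ := hM
  obtain ⟨k1, k2, k3⟩ := hN
  refine ⟨fun i j => by simp [h1 i j, k1 i j], fun i => by simp [h2, k2], fun ξ hξ => ?_⟩
  have : ∑ i, ∑ j, (M + N) i j * ξ i * ξ j =
      ∑ i, ∑ j, M i j * ξ i * ξ j + ∑ i, ∑ j, N i j * ξ i * ξ j := by
    simp only [← Finset.sum_add_distrib, Pi.add_apply, add_mul]
  rw [this]
  exact add_nonpos (h3 ξ hξ) (k3 ξ hξ)

theorem convex_negTypeCone (ι : Type*) [Fintype ι] : Convex ℝ (negTypeCone ι) :=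
  fun _ hM _ hN _ _ ha hb _ =>
    add_mem_negTypeCone (smul_mem_negTypeCone hM ha) (smul_mem_negTypeCone hN hb)

/-- On weights of sum zero the form is `-2 (∑ v ξ) ^ 2`. These elements test positivity of the
separating functional below. -/
theorem sq_sub_mem_negTypeCone {ι : Type*} [Fintype ι] (v : ι → ℝ) :
    (fun i j => (v i - v j) ^ 2) ∈ negTypeCone ι := by
  refine ⟨fun i j => by ring, fun i => by simp, fun ξ hξ => ?_⟩
  have : ∑ i, ∑ j, (v i - v j) ^ 2 * ξ i * ξ j =
      (∑ i, v i ^ 2 * ξ i) * (∑ j, ξ j) + (∑ i, ξ i) * (∑ j, v j ^ 2 * ξ j)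
        - 2 * ((∑ i, v i * ξ i) * ∑ j, v j * ξ j) := by
    simp_rw [Finset.sum_mul_sum, Finset.mul_sum, ← Finset.sum_add_distrib,
      ← Finset.sum_sub_distrib]
    refine Finset.sum_congr rfl fun i _ => Finset.sum_congr rfl fun j _ => by ring
  rw [this, hξ]
  nlinarith [mul_self_nonneg (∑ i, v i * ξ i)]

/-- Duality: if the gap is never positive on positive semidefinite matrices killing the constants,
then some matrix of negative type lies between `w` and `Λ w`. -/
theorem exists_negType_between {ι : Type*} [Fintype ι] {w : ι → ι → ℝ} {Λ : ℝ}
    (hs : ∀ i j, w i j = w j i) (hd : ∀ i, w i i = 0) (hnn : ∀ i j, 0 ≤ w i j) (hΛ : 1 ≤ Λ)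
    (hgap : ∀ q ∈ gramKillingOnes ι, weightedGap w Λ q ≤ 0) :
    ∃ M ∈ negTypeCone ι, ∀ i j, w i j ≤ M i j ∧ M i j ≤ Λ * w i j := by
  classical
  by_contra hcon
  have hdisj : Disjoint (Set.Icc w (Λ • w)) (negTypeCone ι) := by
    rw [Set.disjoint_left]
    intro M hM hN
    exact hcon ⟨M, hN, fun i j => ⟨hM.1 i j, hM.2 i j⟩⟩
  obtain ⟨L, u, v, hu, huv, hv⟩ := geometric_hahn_banach_compact_closed
    (convex_Icc w (Λ • w)) isCompact_Icc (convex_negTypeCone ι) (isClosed_negTypeCone ι) hdisj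
  have hv0 : v < 0 := by
    have := hv 0 ⟨by simp, by simp, by simp⟩
    simpa using this
  -- A negative value could be rescaled to equal `v` exactly, against the strict bound.
  have hcone : ∀ M ∈ negTypeCone ι, 0 ≤ L M := by
    intro M hM
    by_contra hneg
    push Not at hneg
    have := hv _ (smul_mem_negTypeCone hM (c := v / L M) (div_nonneg_of_nonpos hv0.le hneg.le))
    rw [map_smul, smul_eq_mul, div_mul_cancel₀ _ hneg.ne] at this
    exact lt_irrefl _ this
  set a : ι → ι → ℝ := fun i j => L (Pi.single i (Pi.single j 1)) with ha
  have hL : ∀ M, L M = ∑ i, ∑ j, M i j * a i j := by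
    intro M
    have : M = ∑ i, ∑ j, M i j • (Pi.single i (Pi.single j 1) : ι → ι → ℝ) := by
      ext k l
      simp [Finset.sum_apply, Pi.single_apply, ite_apply]
    conv_lhs => rw [this]
    simp [map_sum, ha]
  set b : ι → ι → ℝ := fun i j => (a i j + a j i) / 2 with hb
  have hbs : ∀ i j, b i j = b j i := fun i j => by simp only [hb]; ring
  have hLb : ∀ M : ι → ι → ℝ, (∀ i j, M i j = M j i) → L M = ∑ i, ∑ j, M i j * b i j := by
    intro M hM
    have h2 : L M = ∑ i, ∑ j, M i j * a j i := by
      rw [hL, Finset.sum_comm]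
      exact Finset.sum_congr rfl fun i _ => Finset.sum_congr rfl fun j _ => by rw [hM]
    have h3 : ∑ i, ∑ j, M i j * b i j = (L M + L M) / 2 := by
      nth_rewrite 2 [h2]
      rw [hL, ← Finset.sum_add_distrib, Finset.sum_div]
      refine Finset.sum_congr rfl fun i _ => ?_
      rw [← Finset.sum_add_distrib, Finset.sum_div]
      exact Finset.sum_congr rfl fun j _ => by simp only [hb]; ring
    linarith
  -- The Laplacian of the weights `b`: its quadratic form at `x` is half of `L` applied to `(x i - x
  -- j) ^ 2`.
  set q : ι → ι → ℝ := fun i j => (if i = j then ∑ k, b i k else 0) - b i j with hq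
  have hqmem : q ∈ gramKillingOnes ι := by
    refine ⟨fun i j => ?_, fun i => ?_, fun x => ?_⟩
    · by_cases h : i = j
      · rw [h]
      · simp [hq, h, Ne.symm h, hbs i j]
    · simp [hq, Finset.sum_sub_distrib]
    · have h1 := hcone _ (sq_sub_mem_negTypeCone x)
      rw [hLb _ fun i j => by ring] at h1
      have h2 : ∑ i, ∑ j, x i * q i j * x j =
          ∑ i, ∑ j, x i ^ 2 * b i j - ∑ i, ∑ j, x i * x j * b i j := by
        rw [← Finset.sum_sub_distrib]
        refine Finset.sum_congr rfl fun i _ => ?_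
        simp only [hq, mul_sub, sub_mul, Finset.sum_sub_distrib, mul_ite, ite_mul, mul_zero,
          zero_mul, Finset.sum_ite_eq, Finset.mem_univ, if_true]
        rw [← Finset.mul_sum]
        refine congrArg₂ _ (by ring) (Finset.sum_congr rfl fun j _ => by ring)
      have h3 : ∑ i, ∑ j, x i ^ 2 * b i j = ∑ i, ∑ j, x j ^ 2 * b i j := by
        rw [Finset.sum_comm]
        exact Finset.sum_congr rfl fun i _ => Finset.sum_congr rfl fun j _ => by rw [hbs]
      have h4 : ∑ i, ∑ j, (x i - x j) ^ 2 * b i j =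
          ∑ i, ∑ j, x i ^ 2 * b i j + ∑ i, ∑ j, x j ^ 2 * b i j
            - 2 * ∑ i, ∑ j, x i * x j * b i j := by
        simp_rw [Finset.mul_sum, ← Finset.sum_add_distrib, ← Finset.sum_sub_distrib]
        exact Finset.sum_congr rfl fun i _ => Finset.sum_congr rfl fun j _ => by ring
      rw [h2]
      linarith
  -- The corner of the box where pairing with `q` equals the gap. There `L M < u < v < 0`, so the
  -- gap `-L M` is positive.
  set M : ι → ι → ℝ := fun i j => if 0 < q i j then w i j else Λ * w i j with hMdef
  have hMs : ∀ i j, M i j = M j i := fun i j => by simp only [hMdef, hqmem.1 i j, hs i j]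
  have hMmem : M ∈ Set.Icc w (Λ • w) := by
    refine ⟨fun i j => ?_, fun i j => ?_⟩ <;> simp only [hMdef, Pi.smul_apply, smul_eq_mul] <;>
      split_ifs <;> nlinarith [hnn i j]
  have hMgap : weightedGap w Λ q = ∑ i, ∑ j, M i j * q i j := by
    refine Finset.sum_congr rfl fun i _ => Finset.sum_congr rfl fun j _ => ?_
    simp only [hMdef]
    split_ifs with h
    · rw [max_eq_left h.le, max_eq_right (by linarith)]; ring
    · rw [max_eq_right (not_lt.1 h), max_eq_left (by linarith)]; ring
  have hMq : ∑ i, ∑ j, M i j * q i j = - L M := by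
    rw [hLb M hMs, ← Finset.sum_neg_distrib]
    refine Finset.sum_congr rfl fun i _ => ?_
    rw [← Finset.sum_neg_distrib]
    refine Finset.sum_congr rfl fun j _ => ?_
    by_cases h : i = j
    · subst h
      have : M i i = 0 := by simp [hMdef, hd]
      simp [this]
    · simp [hq, h]
  have := hgap q hqmem
  have := hu M hMmem
  linarith

/-! ### Schoenberg's embedding. -/

/-- Schoenberg's theorem, into `ℓ²`: a matrix of negative type is a squared distance matrix. -/
theorem exists_embedding_of_mem_negTypeCone {n : ℕ} {M : Fin n → Fin n → ℝ}
    (hM : M ∈ negTypeCone (Fin n)) :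
    ∃ f : Fin n → lp (fun _ : ℕ => ℝ) 2, ∀ i j, ‖f i - f j‖ ^ 2 = M i j := by
  rcases n with _ | n
  · exact ⟨fun _ => 0, fun i => i.elim0⟩
  obtain ⟨hs, hd, hneg⟩ := hM
  -- The Gram matrix, by polarization, of a realization that sends point `0` to the origin.
  set g : Fin (n + 1) → Fin (n + 1) → ℝ := fun i j => (M i 0 + M 0 j - M i j) / 2 with hg
  have hgs : ∀ i j, g i j = g j i := fun i j => by
    simp only [hg]; rw [hs i 0, hs 0 j, hs i j]; ring
  have hgp : ∀ v : Fin (n + 1) → ℝ, 0 ≤ ∑ i, ∑ j, v i * g i j * v j := by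
    intro v
    set σ := ∑ i, v i with hσ
    -- The mass is balanced at the base point, where `g` vanishes.
    set ξ : Fin (n + 1) → ℝ := fun i => v i - if i = 0 then σ else 0 with hξ
    have h := hneg ξ (by simp [hξ, Finset.sum_sub_distrib, hσ])
    have e1 : ∑ i, ∑ j, M i j * ξ i * ξ j = ∑ i, ∑ j, M i j * v i * v j
        - σ * ∑ i, M i 0 * v i - σ * ∑ j, M 0 j * v j := by
      have e2 : ∀ i, ∑ j, M i j * ξ i * ξ j =
          ξ i * (∑ j, M i j * v j - M i 0 * σ) := by
        intro i
        have : ∑ j, M i j * ξ j = ∑ j, M i j * v j - M i 0 * σ := by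
          simp [hξ, mul_sub, Finset.sum_sub_distrib]
        rw [← this, Finset.mul_sum]
        exact Finset.sum_congr rfl fun j _ => by ring
      have e3 : ∀ A : Fin (n + 1) → ℝ, ∑ i, ξ i * A i = ∑ i, v i * A i - σ * A 0 := fun A => by
        simp [hξ, sub_mul, Finset.sum_sub_distrib]
      simp_rw [e2]
      rw [e3]
      simp only [hd, mul_sub, Finset.sum_sub_distrib, Finset.mul_sum]
      have c1 : ∀ i j, v i * (M i j * v j) = M i j * v i * v j := fun i j => by ring
      have c2 : ∀ i, v i * (M i 0 * σ) = σ * (M i 0 * v i) := fun i => by ring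
      simp only [c1, c2]
      ring
    have e3 : ∑ i, ∑ j, v i * g i j * v j = (σ * ∑ i, M i 0 * v i + σ * ∑ j, M 0 j * v j
        - ∑ i, ∑ j, M i j * v i * v j) / 2 := by
      have c1 : σ * ∑ i, M i 0 * v i = ∑ i, ∑ j, M i 0 * v i * v j := by
        rw [mul_comm, hσ, Finset.sum_mul_sum]
      have c2 : σ * ∑ j, M 0 j * v j = ∑ i, ∑ j, v i * (M 0 j * v j) := by
        rw [hσ, Finset.sum_mul_sum]
      rw [c1, c2]
      simp_rw [← Finset.sum_add_distrib, ← Finset.sum_sub_distrib, Finset.sum_div]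
      exact Finset.sum_congr rfl fun i _ => Finset.sum_congr rfl fun j _ => by
        simp only [hg]; ring
    rw [e3]
    linarith
  obtain ⟨B, hB⟩ := exists_gram_factor hgs hgp
  set e : Fin (n + 1) → lp (fun _ : ℕ => ℝ) 2 := fun k => lp.single 2 (k : ℕ) (1 : ℝ) with he
  have horth : Orthonormal ℝ e := by
    rw [orthonormal_iff_ite]
    intro i j
    simp [he, lp.inner_single_left, Pi.single_apply, Fin.ext_iff]
  refine ⟨fun i => ∑ k, B k i • e k, fun i j => ?_⟩
  have hin : ∀ i j, inner ℝ (∑ k, B k i • e k) (∑ k, B k j • e k) = g i j := by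
    intro i j
    rw [horth.inner_sum, hB]
    simp
  rw [norm_sub_sq_real, ← real_inner_self_eq_norm_sq, ← real_inner_self_eq_norm_sq, hin, hin, hin]
  simp only [hg, hd, hs 0 j, hs 0 i]
  ring

/-! ### Negative type and distortion expressed through the gap. -/

theorem sum_sum_pushforward {ι κ : Type*} [Fintype ι] [Fintype κ] [DecidableEq ι] (y : κ → ι)
    (ξ : κ → ℝ) (w : ι → ι → ℝ) :
    ∑ a, ∑ b, w (y a) (y b) * ξ a * ξ b =
      ∑ i, ∑ j, w i j * ((∑ a, if y a = i then ξ a else 0) * ∑ a, if y a = j then ξ a else 0) := by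
  have key : ∀ g : ι → ℝ, ∑ i, g i * (∑ a, if y a = i then ξ a else 0) = ∑ a, g (y a) * ξ a := by
    intro g
    simp_rw [Finset.mul_sum]
    rw [Finset.sum_comm]
    simp
  have h1 : ∀ i, ∑ j, w i j * ((∑ a, if y a = i then ξ a else 0) *
      ∑ a, if y a = j then ξ a else 0) =
      (∑ b, w i (y b) * ξ b) * (∑ a, if y a = i then ξ a else 0) := by
    intro i
    rw [← key, Finset.sum_mul]
    exact Finset.sum_congr rfl fun j _ => by ring
  simp_rw [h1]
  rw [key]
  refine Finset.sum_congr rfl fun a _ => ?_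
  rw [Finset.sum_mul]
  exact Finset.sum_congr rfl fun b _ => by ring

theorem rankOne_mem_gramKillingOnes {ι : Type*} [Fintype ι] {η : ι → ℝ} (h : ∑ i, η i = 0) :
    (fun i j => η i * η j) ∈ gramKillingOnes ι := by
  refine ⟨fun i j => mul_comm _ _, fun i => by rw [← Finset.mul_sum, h, mul_zero], fun v => ?_⟩
  have : ∑ i, ∑ j, v i * (η i * η j) * v j = (∑ i, v i * η i) * ∑ j, v j * η j := by
    rw [Finset.sum_mul_sum]
    exact Finset.sum_congr rfl fun i _ => Finset.sum_congr rfl fun j _ => by ring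
  rw [this]
  exact mul_self_nonneg _

namespace SemiMetric

variable {X : Type*}

theorem d_pos (D : SemiMetric X) {x y : X} (h : x ≠ y) : 0 < D.d x y :=
  lt_of_le_of_ne (D.nonneg x y) fun h0 => h ((D.eq_zero_iff x y).1 h0.symm)

theorem d_self (D : SemiMetric X) (x : X) : D.d x x = 0 := (D.eq_zero_iff x x).2 rfl

/-- The convention `0 ^ 0 = 0` keeps the diagonal constant, so continuity holds at exponent `0` too.
-/
theorem continuous_pow_d (D : SemiMetric X) (x y : X) :
    Continuous fun r : ℝ => (D.pow r).d x y := by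
  by_cases h : x = y
  · simp only [h, d_self]; exact continuous_const
  · simp only [pow, h, if_false]
    exact Real.continuous_const_rpow (D.d_pos h).ne'

theorem pow_half_d_sq (D : SemiMetric X) (p : ℝ) (x y : X) :
    (D.pow (p / 2)).d x y ^ 2 = (D.pow p).d x y := by
  by_cases h : x = y
  · simp [h, d_self]
  · simp only [pow, h, if_false]
    rw [← Real.rpow_natCast, ← Real.rpow_mul (D.nonneg x y)]
    congr 1
    push_cast
    ring

/-- Negative type can be tested against `gramKillingOnes`. -/
theorem hasNegativeType_of_gap {n : ℕ} (D : SemiMetric X) (e : Fin n ≃ X) (p : ℝ≥0)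
    (h : ∀ q ∈ gramKillingOnes (Fin n),
      weightedGap (fun i j => (D.pow p).d (e i) (e j)) 1 q ≤ 0) :
    D.HasNegativeType p := by
  intro m _ x _ ξ hξ
  have h1 := sum_sum_pushforward (fun a => e.symm (x a)) ξ (fun i j => (D.pow p).d (e i) (e j))
  simp only [Equiv.apply_symm_apply] at h1
  rw [h1, ← weightedGap_one]
  refine h _ (rankOne_mem_gramKillingOnes ?_)
  rw [Finset.sum_comm]
  simpa using hξ

theorem optimalDistortion_eq {Y : Type*} (D : SemiMetric X) (E : SemiMetric Y) {C : ℝ}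
    (hC : 1 ≤ C) (hf : ∃ f : X → Y, DistortionAtMost D E f C)
    (hmin : ∀ (f : X → Y) (C' : ℝ), 1 ≤ C' → DistortionAtMost D E f C' → C ≤ C') :
    optimalDistortion D E = ENNReal.ofReal C := by
  apply le_antisymm
  · obtain ⟨f, hf⟩ := hf
    refine sInf_le ⟨by simpa using ENNReal.ofReal_le_ofReal hC, f, sInf_le ⟨C, hC, hf, rfl⟩⟩
  · refine le_sInf ?_
    rintro t ⟨_, f, hft⟩
    refine le_trans (le_sInf ?_) hft
    rintro s ⟨C', hC', hd, rfl⟩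
    exact ENNReal.ofReal_le_ofReal (hmin f C' hC' hd)

/-- A map into `ℓ²` of distortion at most `C` forces the gap with parameter `C ^ 2` to be
non-positive. -/
theorem weightedGap_nonpos_of_distortionAtMost {n : ℕ} (D : SemiMetric X) (e : Fin n → X) (p : ℝ)
    {C : ℝ} (f : X → lp (fun _ : ℕ => ℝ) 2)
    (hf : DistortionAtMost (D.pow (p / 2)) (ofMetricSpace _) f C) {q : Fin n → Fin n → ℝ}
    (hq : q ∈ gramKillingOnes (Fin n)) :
    weightedGap (fun i j => (D.pow p).d (e i) (e j)) (C ^ 2) q ≤ 0 := by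
  obtain ⟨s, hs, hf⟩ := hf
  have hd : ∀ x y, (ofMetricSpace (lp (fun _ : ℕ => ℝ) 2)).d (f x) (f y) = ‖f x - f y‖ :=
    fun x y => dist_eq_norm _ _
  simp only [hd] at hf
  have hM : ∀ i j, ‖s⁻¹ • f (e i) - s⁻¹ • f (e j)‖ ^ 2 =
      (s⁻¹ * ‖f (e i) - f (e j)‖) ^ 2 := fun i j => by
    rw [← smul_sub, norm_smul, Real.norm_of_nonneg (inv_nonneg.2 hs.le)]
  refine (weightedGap_le (M := fun i j => ‖s⁻¹ • f (e i) - s⁻¹ • f (e j)‖ ^ 2)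
    (fun i j => ?_) (fun i j => ?_) q).trans
      (sum_sq_dist_mul_nonpos (fun i => s⁻¹ • f (e i)) hq)
  · rw [hM, ← D.pow_half_d_sq]
    refine pow_le_pow_left₀ ((D.pow _).nonneg _ _) ?_ 2
    rw [inv_mul_eq_div, le_div_iff₀ hs, mul_comm]
    exact (hf _ _).1
  · rw [hM, ← D.pow_half_d_sq, ← mul_pow]
    refine pow_le_pow_left₀ (by positivity) ?_ 2
    rw [inv_mul_eq_div, div_le_iff₀ hs]
    exact (hf _ _).2.trans_eq (by ring)

/-- If the gap with parameter `C ^ 2` is never positive, some map into `ℓ²` has distortion at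
most `C`. -/
theorem exists_distortionAtMost_of_weightedGap_nonpos {n : ℕ} (D : SemiMetric X) (e : Fin n ≃ X)
    (p : ℝ) {C : ℝ} (hC : 1 ≤ C)
    (h : ∀ q ∈ gramKillingOnes (Fin n),
      weightedGap (fun i j => (D.pow p).d (e i) (e j)) (C ^ 2) q ≤ 0) :
    ∃ f : X → lp (fun _ : ℕ => ℝ) 2,
      DistortionAtMost (D.pow (p / 2)) (ofMetricSpace _) f C := by
  obtain ⟨M, hM, hb⟩ := exists_negType_between (fun i j => (D.pow p).symm (e i) (e j))
    (fun i => (D.pow p).d_self (e i)) (fun i j => (D.pow p).nonneg (e i) (e j))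
    (one_le_pow₀ hC) h
  obtain ⟨f, hf⟩ := exists_embedding_of_mem_negTypeCone hM
  refine ⟨fun x => f (e.symm x), 1, one_pos, fun x y => ?_⟩
  have hd : (ofMetricSpace (lp (fun _ : ℕ => ℝ) 2)).d (f (e.symm x)) (f (e.symm y)) =
      ‖f (e.symm x) - f (e.symm y)‖ := dist_eq_norm _ _
  have h1 := hb (e.symm x) (e.symm y)
  rw [← hf, e.apply_symm_apply, e.apply_symm_apply, ← D.pow_half_d_sq, ← mul_pow] at h1
  have hn := (D.pow (p / 2)).nonneg x y
  rw [hd, one_mul, one_mul]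
  exact ⟨le_of_sq_le_sq h1.1 (norm_nonneg _),
    le_of_sq_le_sq h1.2 (mul_nonneg (by linarith) hn)⟩

end SemiMetric

/-! ### Perturbation and the conclusion. -/

/-- A strict bound on the compact base persists for nearby parameters. -/
theorem eventually_gap_nonpos {ι : Type*} [Fintype ι] {F : ℝ → (ι → ι → ℝ) → ℝ}
    (hF : Continuous fun t : ℝ × (ι → ι → ℝ) => F t.1 t.2)
    (hsmul : ∀ t q (c : ℝ), 0 ≤ c → F t (c • q) = c * F t q) {t₀ : ℝ}
    (h : ∀ q ∈ gramKillingOnes ι, q ≠ 0 → F t₀ q < 0) :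
    ∀ᶠ t in nhds t₀, ∀ q ∈ gramKillingOnes ι, F t q ≤ 0 := by
  have h1 : ∀ᶠ t in nhds t₀, ∀ q ∈ gramKillingOnes ι ∩ Metric.sphere 0 1, F t q < 0 := by
    refine (isCompact_gramKillingOnes_sphere ι).eventually_forall_of_forall_eventually ?_
    intro q hq
    refine hF.continuousAt.eventually_lt_const (h q hq.1 ?_)
    rintro rfl
    simpa using hq.2
  filter_upwards [h1] with t ht q hq
  by_cases h0 : q = 0
  · have := hsmul t q 0 le_rfl
    rw [h0] at this ⊢
    simpa using this.le
  · have h2 := ht _ (normalize_mem_sphere hq h0)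
    rw [hsmul t q _ (by positivity)] at h2
    have h3 : 0 < ‖q‖⁻¹ := by positivity
    exact (neg_of_mul_neg_right h2 h3.le).le

theorem corollary3p7 {X : Type*} [Finite X] (D : SemiMetric X) (p : ℝ≥0)
    (hp : D.supremalNegativeType ≤ (p : ℝ≥0∞)) :
    ∃ C : ℝ, 1 ≤ C ∧ (D.pow ((p : ℝ) / 2)).euclideanDistortion = ENNReal.ofReal C ∧
      D.HasNontrivialPolygonalEquality p C := by
  obtain ⟨n, ⟨e'⟩⟩ := Finite.exists_equiv_fin X
  set e := e'.symm with he
  set w : ℝ → Fin n → Fin n → ℝ := fun r i j => (D.pow r).d (e i) (e j) with hw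
  set S : Set ℝ := {Λ | 1 ≤ Λ ∧ ∀ q ∈ gramKillingOnes (Fin n), weightedGap (w p) Λ q ≤ 0} with hS
  have hSne : S.Nonempty := exists_weightedGap_nonpos (fun i => (D.pow p).d_self _)
    (fun i j h => (D.pow p).d_pos (e.injective.ne h))
  have hSclosed : IsClosed S := by
    have : S = Set.Ici 1 ∩ ⋂ q ∈ gramKillingOnes (Fin n), {Λ | weightedGap (w p) Λ q ≤ 0} := by
      ext; simp [hS]
    rw [this]
    refine isClosed_Ici.inter (isClosed_biInter fun q _ => ?_)
    exact isClosed_le ((continuous_weightedGap (w p)).comp (by fun_prop : Continuous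
      fun Λ : ℝ => (Λ, q))) continuous_const
  have hSbdd : BddBelow S := ⟨1, fun _ h => h.1⟩
  set Λ := sInf S with hΛ
  obtain ⟨h1, hgap⟩ : Λ ∈ S := hSclosed.csInf_mem hSne hSbdd
  have hsq : Real.sqrt Λ ^ 2 = Λ := Real.sq_sqrt (by linarith)
  have hC : 1 ≤ Real.sqrt Λ := Real.one_le_sqrt.2 h1
  refine ⟨Real.sqrt Λ, hC, SemiMetric.optimalDistortion_eq _ _ hC
    (D.exists_distortionAtMost_of_weightedGap_nonpos e p hC (by rwa [hsq])) ?_, ?_⟩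
  · intro f C' hC' hf
    refine Real.sqrt_le_iff.2 ⟨by linarith, csInf_le hSbdd ⟨one_le_pow₀ hC', fun q hq => ?_⟩⟩
    exact D.weightedGap_nonpos_of_distortionAtMost e p f hf hq
  by_contra hno
  have hlt : ∀ q ∈ gramKillingOnes (Fin n), q ≠ 0 → weightedGap (w p) Λ q < 0 := by
    intro q hq h0
    refine lt_of_le_of_ne (hgap q hq) fun heq => hno ⟨n, e, Matrix.of q, ⟨?_, e.injective,
      mem_posSemidefKillingOnes_iff.2 hq, ?_⟩, h0⟩
    -- For `n ≤ 1`, vanishing row sums force `q = 0`.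
    · by_contra hn
      refine h0 (funext fun i => funext fun j => ?_)
      have : Subsingleton (Fin n) := Fin.subsingleton_iff_le_one.2 (by omega)
      have hr := hq.2.1 i
      rwa [Fintype.sum_subsingleton _ j] at hr
    · rw [SemiMetric.distortedSum_eq_weightedGap, hsq]
      exact heq
  rcases h1.eq_or_lt with h1 | h1
  -- `Λ` cannot go below `1`, so the exponent is perturbed upwards instead.
  · rw [← h1] at hlt
    have hcont : Continuous fun t : ℝ × (Fin n → Fin n → ℝ) => weightedGap (w t.1) 1 t.2 := by
      simp only [weightedGap_one]
      refine continuous_finsetSum _ fun i _ => continuous_finsetSum _ fun j _ => ?_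
      exact ((D.continuous_pow_d (e i) (e j)).comp continuous_fst).mul (by fun_prop)
    have hev := eventually_gap_nonpos hcont
      (fun t q c hc => weightedGap_smul _ _ _ hc) hlt
    obtain ⟨r, hr, hpr⟩ := ((hev.filter_mono nhdsWithin_le_nhds).and
      (eventually_mem_nhdsWithin (s := Set.Ioi (p : ℝ)))).exists
    have hpr' : (p : ℝ) < r := hpr
    lift r to ℝ≥0 using p.2.trans hpr'.le
    have hneg : D.HasNegativeType r := D.hasNegativeType_of_gap e r hr
    have hle : (r : ℝ≥0∞) ≤ D.supremalNegativeType := le_sSup ⟨r, hneg, rfl⟩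
    have : (r : ℝ≥0∞) ≤ p := hle.trans hp
    exact absurd (ENNReal.coe_le_coe.1 this) (not_le.2 (NNReal.coe_lt_coe.1 hpr'))
  -- Here `Λ > 1` leaves room for a smaller admissible `t ∈ (1, Λ)`.
  · have hev := eventually_gap_nonpos (continuous_weightedGap (w p))
      (fun t q c hc => weightedGap_smul _ _ _ hc) hlt
    obtain ⟨t, ht, htΛ, h1t⟩ := ((hev.filter_mono (nhdsWithin_le_nhds (s := Set.Iio Λ))).and
      ((eventually_mem_nhdsWithin (s := Set.Iio Λ)).and
        ((eventually_gt_nhds h1).filter_mono nhdsWithin_le_nhds))).exists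
    exact absurd (csInf_le hSbdd ⟨le_of_lt h1t, ht⟩) (not_le.2 htΛ)
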